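/- Fix the standard acceptable enumeration $(\varphi_e)_{e\in\mathbb N}$ of the partial computable functions $\mathbb N\rightharpoonup\mathbb N$. A number $e$ is an \emph{index of a computable group} if there is a group $G$ whose universe is a subset of $\mathbb N$ such that $\varphi_e$ is the (total) characteristic function of its atomic diagram, i.e. of the set of codes of the triples $(x,y,xy)$ with $x,y\in G$; the index determines $G$. Let $A$ be the set of all indices of computable groups and, for a property $P$ of groups, let $B_P\subseteq A$ be the set of indices of computable groups that have $P$. A set $S\subseteq\mathbb N$ is $\Pi^0_1$ if $S=\{e : \forall n\, R(e,n)\}$ for some computable relation $R$. Detecting $P$ is \emph{$\Pi^0_1$-complete in the class of computable groups} if 1. there is a $\Pi^0_1$ set $\Phi$ with $B_P=A\cap\Phi$, and 2. for every $\Pi^0_1$ set $S$ there is a computable function $f:\mathbb N\to\mathbb N$ with $f(e)\in A$ for all $e$, such that for all $e$: $e\in S$ if and only if $f(e)\in B_P$. **Corollary.** Detecting each of the following properties is $\Pi^0_1$-complete in the class of computable groups: - being abelian; - being torsion-free (no element other than the identity has finite order); - being totally left-orderable (there is a total order $\preceq$ on $G$ with $g\preceq h\Rightarrow ag\preceq ah$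 for all $a,g,h\in G$); - being totally bi-orderable (there is a total order on $G$ that is invariant under multiplication from the left and from the right). -/

import Mathlib

namespace GroupDetection

/-- The `e`-th partial computable function, in the standard acceptable enumeration. -/
def phi (e : ℕ) : ℕ →. ℕ :=
  (Denumerable.ofNat Nat.Partrec.Code e).eval

/-- `phi e` is the (total, `0`-`1`-valued) characteristic function of `D`. -/
def Decides (e : ℕ) (D : Set ℕ) : Prop :=
  ∀ n : ℕ, (n ∈ D → 1 ∈ phi e n) ∧ (n ∉ D → 0 ∈ phi e n)

/-- The atomic diagram (multiplication table) of a group whose universe is a set `U` of natural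
numbers: the codes of all triples `(x, y, x * y)` with `x, y ∈ U`. Equality of elements of `U` is
equality of natural numbers, and `x ∈ U` if and only if `(x, 1, x)` is in the table. -/
def atomicDiagram (U : Set ℕ) [Group U] : Set ℕ :=
  {n | ∃ x y : U, n = Nat.pair (x : ℕ) (Nat.pair (y : ℕ) ((x * y : U) : ℕ))}

/-- `e` is an index of the computable group with universe `U`. -/
def IsIndexOf (e : ℕ) (U : Set ℕ) [Group U] : Prop :=
  Decides e (atomicDiagram U)

/-- The set of all indices of computable groups. -/
def computableGroupIndices : Set ℕ :=
  {e | ∃ (U : Set ℕ) (_ : Group U), IsIndexOf e U}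

/-- The set of all indices of computable groups with the property `P`. (The index determines the
universe and the multiplication.) -/
def indicesWith (P : ∀ (G : Type) [Group G], Prop) : Set ℕ :=
  {e | ∃ (U : Set ℕ) (_ : Group U), IsIndexOf e U ∧ P U}

/-- `S` is defined by a formula `∀ n, R e n` with computable `R`. -/
def IsPi01 (S : Set ℕ) : Prop :=
  ∃ R : ℕ → ℕ → Prop, ComputablePred (fun p : ℕ × ℕ => R p.1 p.2) ∧ S = {e | ∀ n, R e n}

/-- Detecting `P` is `Γ` in the class of computable groups. -/
def DetectionIn (Γ : Set ℕ → Prop) (P : ∀ (G : Type) [Group G], Prop) : Prop :=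
  ∃ Φ : Set ℕ, Γ Φ ∧ computableGroupIndices ∩ Φ = indicesWith P

/-- Detecting `P` is `Γ`-hard in the class of computable groups. -/
def DetectionHard (Γ : Set ℕ → Prop) (P : ∀ (G : Type) [Group G], Prop) : Prop :=
  ∀ S : Set ℕ, Γ S → ∃ f : ℕ → ℕ, Computable f ∧ (∀ e, f e ∈ computableGroupIndices) ∧
    ∀ e, e ∈ S ↔ f e ∈ indicesWith P

/-- Detecting `P` is `Γ`-complete in the class of computable groups. -/
def DetectionComplete (Γ : Set ℕ → Prop) (P : ∀ (G : Type) [Group G], Prop) : Prop :=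
  DetectionIn Γ P ∧ DetectionHard Γ P

/-- `G` is abelian. -/
def Abelian (G : Type) [Group G] : Prop :=
  ∀ x y : G, x * y = y * x

/-- `G` is torsion-free: only the identity has finite order. (For non-abelian groups this is weaker
than `IsMulTorsionFree`, which asks for unique roots.) -/
def TorsionFree (G : Type) [Group G] : Prop :=
  ∀ g : G, IsOfFinOrder g → g = 1

/-- `G` admits a left-invariant total order. -/
def LeftOrderable (G : Type) [Group G] : Prop :=
  ∃ _ : LinearOrder G, ∀ a g h : G, g ≤ h → a * g ≤ a * h

/-- `G` admits a total order that is invariant under multiplication from both sides. -/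
def BiOrderable (G : Type) [Group G] : Prop :=
  ∃ _ : LinearOrder G, ∀ a g h : G, g ≤ h → a * g ≤ a * h ∧ g * a ≤ h * a

end GroupDetection

/-! Upper bound: for an index `e` of a group, each property holds iff some bit sequence `X`
satisfies a primitive recursive list of clauses "if these values of `phi e` are as stated, then one
of these bits is as stated". For the two kinds of orders, `X` is the positive cone, for
torsion-freeness a relation containing all pairs of an element and a positive power of it. By
compactness of Cantor space, `X` exists iff for every `n` the first `n` groups of clauses, with `n`
steps of computation and `n` bits visible, are satisfied by one of `2 ^ n` bit strings
(`exists_forall_holds_iff`). This is a `Π⁰₁` condition.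

Hardness: one construction serves all four properties. Given a computable `r`, build a copy of `ℤ`
and add reflections, giving the infinite dihedral group, iff `r (e, n)` fails for some `n`. Codes of
reflections carry the least such `n`, so the table is decidable although the case distinction is
not. `ℤ` is abelian and bi-orderable; the dihedral group is neither abelian nor torsion-free. As
bi-orderable implies left-orderable implies torsion-free, `detectionComplete_of_iff` applies to
every property in the list. -/

namespace GroupDetection

/-! ### Clauses about a bit sequence, and compactness -/

open Nat.Partrec

/-- A conditional clause: a finite list of facts `v ∈ phi e n`, followed by a disjunction of
literals `X i = b` about an unknown bit sequence `X`. -/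
abbrev Rule : Type := List (ℕ × ℕ) × List (ℕ × Bool)

/-- The clause of `r` is true of `X` if all the facts of `r` are true of `e`. -/
def Rule.Holds (e : ℕ) (X : ℕ → Bool) (r : Rule) : Prop :=
  (∀ p ∈ r.1, p.2 ∈ phi e p.1) → ∃ l ∈ r.2, X l.1 = l.2

/-- The approximation of `Rule.Holds` which runs `phi e` for `n` steps and ignores the bits of `X`
beyond the `n`-th. -/
def Rule.HoldsAt (e n : ℕ) (X : ℕ → Bool) (r : Rule) : Prop :=
  (∃ p ∈ r.1, Code.evaln n (Denumerable.ofNat Code e) p.1 ≠ some p.2) ∨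
    ∃ l ∈ r.2, n ≤ l.1 ∨ X l.1 = l.2

theorem Rule.HoldsAt.anti {e n m : ℕ} {X : ℕ → Bool} {r : Rule} (h : r.HoldsAt e m X)
    (hnm : n ≤ m) : r.HoldsAt e n X := by
  rcases h with ⟨p, hp, h⟩ | ⟨l, hl, h⟩
  · exact .inl ⟨p, hp, fun h' => h (Code.evaln_mono hnm h')⟩
  · exact .inr ⟨l, hl, h.imp_left hnm.trans⟩

theorem Rule.Holds.holdsAt {e : ℕ} {X : ℕ → Bool} {r : Rule} (h : r.Holds e X) (n : ℕ) :
    r.HoldsAt e n X := by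
  by_cases hp : ∃ p ∈ r.1, Code.evaln n (Denumerable.ofNat Code e) p.1 ≠ some p.2
  · exact .inl hp
  · push Not at hp
    obtain ⟨l, hl, h⟩ := h fun p hpr => Code.evaln_sound (hp p hpr)
    exact .inr ⟨l, hl, .inr h⟩

/-- A rule is finite, so some stage verifies all its true premises and sees all its bits. -/
theorem Rule.holds_of_forall_holdsAt {e : ℕ} {X : ℕ → Bool} {r : Rule}
    (h : ∀ n, r.HoldsAt e n X) : r.Holds e X := by
  intro hp
  have hk : ∃ k, ∀ p ∈ r.1, Code.evaln k (Denumerable.ofNat Code e) p.1 = some p.2 := by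
    generalize r.1 = ps at hp
    induction ps with
    | nil => exact ⟨0, by simp⟩
    | cons p ps ih =>
      obtain ⟨k, hk⟩ := ih fun p hp' => hp p (List.mem_cons_of_mem _ hp')
      obtain ⟨k', hk'⟩ := Code.evaln_complete.1 (hp p List.mem_cons_self)
      refine ⟨max k k', List.forall_mem_cons.2 ⟨?_, fun p hp => ?_⟩⟩
      · exact Code.evaln_mono (le_max_right k k') hk'
      · exact Code.evaln_mono (le_max_left k k') (hk p hp)
  have hN : ∃ N, ∀ l ∈ r.2, l.1 < N := by
    generalize r.2 = ls
    induction ls with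
    | nil => exact ⟨0, by simp⟩
    | cons l ls ih =>
      obtain ⟨N, hN⟩ := ih
      refine ⟨max N (l.1 + 1), List.forall_mem_cons.2 ⟨by simp, fun l hl => ?_⟩⟩
      exact (hN l hl).trans_le (le_max_left _ _)
  obtain ⟨k, hk⟩ := hk
  obtain ⟨N, hN⟩ := hN
  rcases (h (max k N)) with ⟨p, hp, h⟩ | ⟨l, hl, h⟩
  · exact absurd (Code.evaln_mono (le_max_left k N) (hk p hp)) h
  · refine ⟨l, hl, h.resolve_left fun h' => ?_⟩
    exact absurd (hN l hl) (not_lt.2 ((le_max_right k N).trans h'))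

theorem Rule.isClosed_setOf_holdsAt (e n : ℕ) (r : Rule) :
    IsClosed {X : ℕ → Bool | r.HoldsAt e n X} := by
  have h : {X : ℕ → Bool | r.HoldsAt e n X} =
      {_X | ∃ p ∈ r.1, Code.evaln n (Denumerable.ofNat Code e) p.1 ≠ some p.2} ∪
        ⋃ l ∈ {l | l ∈ r.2}, {X | n ≤ l.1 ∨ X l.1 = l.2} := by
    ext X; simp [Rule.HoldsAt]
  rw [h]
  refine isClosed_const.union ((List.finite_toSet r.2).isClosed_biUnion fun l _ => ?_)
  exact isClosed_const.union (isClosed_eq (continuous_apply l.1) continuous_const)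

/-- **Compactness**: a sequence of rules is satisfiable if all its finite approximations are. -/
theorem exists_forall_holds_iff (e : ℕ) (rules : ℕ → List Rule) :
    (∃ X, ∀ q, ∀ r ∈ rules q, r.Holds e X) ↔
      ∀ n, ∃ m < 2 ^ n, ∀ q < n, ∀ r ∈ rules q, r.HoldsAt e n m.testBit := by
  constructor
  · rintro ⟨X, hX⟩ n
    refine ⟨Nat.ofBits fun i : Fin n => X i, Nat.ofBits_lt_two_pow _, fun q _ r hr => ?_⟩
    rcases (hX q r hr).holdsAt n with h | ⟨l, hl, h⟩
    · exact .inl h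
    · refine .inr ⟨l, hl, or_iff_not_imp_left.2 fun hn => ?_⟩
      rw [Nat.testBit_ofBits_lt _ _ (not_le.1 hn)]
      exact h.resolve_left hn
  · intro h
    -- The solution sets of the approximations are nonempty, closed and decreasing in `n`, so they
    -- share a point.
    obtain ⟨X, hX⟩ := IsCompact.nonempty_iInter_of_sequence_nonempty_isCompact_isClosed
      (fun n => {X : ℕ → Bool | ∀ q < n, ∀ r ∈ rules q, r.HoldsAt e n X})
      (fun n X hX q hq r hr => (hX q (hq.trans n.lt_succ_self) r hr).anti n.le_succ)
      (fun n => let ⟨m, _, hm⟩ := h n; ⟨m.testBit, hm⟩)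
      (by simp [isCompact_univ])
      (fun n => by
        simp only [Set.ofPred_forall]
        exact isClosed_iInter fun q => isClosed_iInter fun _ => isClosed_iInter fun r =>
          isClosed_iInter fun _ => r.isClosed_setOf_holdsAt e n)
    refine ⟨X, fun q r hr => Rule.holds_of_forall_holdsAt fun n => ?_⟩
    have := Set.mem_iInter.1 hX (max n (q + 1)) q (by simp) r hr
    exact this.anti (le_max_left _ _)

theorem primrec_nat_pow : Primrec₂ ((· ^ ·) : ℕ → ℕ → ℕ) :=
  Primrec₂.unpaired'.1 Nat.Primrec.pow

theorem primrec_testBit : Primrec₂ Nat.testBit := by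
  have h : PrimrecPred fun p : ℕ × ℕ => p.1 / 2 ^ p.2 % 2 = 1 :=
    Primrec.eq.comp (Primrec.nat_mod.comp (Primrec.nat_div.comp .fst
      (primrec_nat_pow.comp (.const 2) .snd)) (.const 2)) (.const 1)
  exact h.decide.of_eq fun p => by simp [Nat.testBit_eq_decide_div_mod_eq]

theorem Rule.primrecRel_holdsAt :
    PrimrecRel fun (r : Rule) (c : (ℕ × ℕ) × ℕ) => r.HoldsAt c.1.1 c.1.2 c.2.testBit := by
  have h₁ : PrimrecRel fun (p : ℕ × ℕ) (c : (ℕ × ℕ) × ℕ) =>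
      Code.evaln c.1.2 (Denumerable.ofNat Code c.1.1) p.1 ≠ some p.2 := by
    refine (Primrec.eq.comp (Code.primrec_evaln.comp (.pair (.pair
      (Primrec.snd.comp (Primrec.fst.comp .snd)) ((Primrec.ofNat Code).comp
        (Primrec.fst.comp (Primrec.fst.comp .snd)))) (Primrec.fst.comp .fst)))
      (Primrec.option_some.comp (Primrec.snd.comp .fst))).not
  have h₂ : PrimrecRel fun (l : ℕ × Bool) (c : (ℕ × ℕ) × ℕ) =>
      c.1.2 ≤ l.1 ∨ c.2.testBit l.1 = l.2 := by
    refine PrimrecPred.or (Primrec.nat_le.comp (Primrec.snd.comp (Primrec.fst.comp .snd))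
      (Primrec.fst.comp .fst)) (Primrec.eq.comp (primrec_testBit.comp (Primrec.snd.comp .snd)
        (Primrec.fst.comp .fst)) (Primrec.snd.comp .fst))
  exact (h₁.exists_mem_list.comp (Primrec.fst.comp .fst) .snd).or
    (h₂.exists_mem_list.comp (Primrec.snd.comp .fst) .snd)

theorem primrecRel_forall_lt {α : Type*} [Primcodable α] {R : ℕ → α → Prop} (h : PrimrecRel R) :
    PrimrecRel fun n a => ∀ m < n, R m a :=
  (h.forall_mem_list.comp (Primrec.list_range.comp .fst) .snd).of_eq fun p => by simp

theorem primrecRel_exists_lt {α : Type*} [Primcodable α] {R : ℕ → α → Prop} (h : PrimrecRel R) :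
    PrimrecRel fun n a => ∃ m < n, R m a :=
  (h.exists_mem_list.comp (Primrec.list_range.comp .fst) .snd).of_eq fun p => by simp

/-- The satisfiability of a primitive recursive sequence of rules is `Π⁰₁`. -/
theorem isPi01_satisfiable {rules : ℕ → List Rule} (h : Primrec rules) :
    IsPi01 {e | ∃ X, ∀ q, ∀ r ∈ rules q, r.Holds e X} := by
  refine ⟨fun e n => ∃ m < 2 ^ n, ∀ q < n, ∀ r ∈ rules q, r.HoldsAt e n m.testBit, ?_,
    by ext e; exact exists_forall_holds_iff e rules⟩
  have h₁ : PrimrecRel fun (q : ℕ) (c : (ℕ × ℕ) × ℕ) =>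
      ∀ r ∈ rules q, r.HoldsAt c.1.1 c.1.2 c.2.testBit :=
    Rule.primrecRel_holdsAt.forall_mem_list.comp (h.comp .fst) .snd
  have h₂ : PrimrecRel fun (m : ℕ) (p : ℕ × ℕ) =>
      ∀ q < p.2, ∀ r ∈ rules q, r.HoldsAt p.1 p.2 m.testBit :=
    (primrecRel_forall_lt h₁).comp (Primrec.snd.comp .snd) (Primrec.pair .snd .fst)
  exact PrimrecPred.computablePred ((primrecRel_exists_lt h₂).comp
    (primrec_nat_pow.comp (.const 2) .snd) .id)


/-! ### Reading the atomic diagram -/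

/-- The code of a triple. -/
def triple (x y z : ℕ) : ℕ := Nat.pair x (Nat.pair y z)

theorem primrec_triple {α : Type*} [Primcodable α] {f g h : α → ℕ} (hf : Primrec f)
    (hg : Primrec g) (hh : Primrec h) : Primrec fun a => triple (f a) (g a) (h a) :=
  Primrec₂.natPair.comp hf (Primrec₂.natPair.comp hg hh)

theorem triple_inj {x y z x' y' z' : ℕ} :
    triple x y z = triple x' y' z' ↔ x = x' ∧ y = y' ∧ z = z' := by
  simp [triple, Nat.pair_eq_pair]

theorem triple_mem_atomicDiagram {U : Set ℕ} [Group U] {x y z : ℕ} :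
    triple x y z ∈ atomicDiagram U ↔ ∃ a b : U, x = a ∧ y = b ∧ z = (a * b : U) :=
  exists₂_congr fun _ _ => triple_inj

theorem coe_triple_mem_atomicDiagram {U : Set ℕ} [Group U] {a b c : U} :
    triple a b c ∈ atomicDiagram U ↔ a * b = c := by
  rw [triple_mem_atomicDiagram]
  constructor
  · rintro ⟨a', b', ha, hb, hc⟩
    rw [Subtype.ext ha, Subtype.ext hb, Subtype.ext hc]
  · rintro rfl
    exact ⟨a, b, rfl, rfl, rfl⟩

/-- The identity is the only idempotent of a group; this lets the rules speak of it. -/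
theorem triple_self_mem_atomicDiagram {U : Set ℕ} [Group U] {x : ℕ} :
    triple x x x ∈ atomicDiagram U ↔ x = (1 : U) := by
  constructor
  · intro h
    obtain ⟨a, b, rfl, -⟩ := triple_mem_atomicDiagram.1 h
    rw [mul_eq_left.1 (coe_triple_mem_atomicDiagram.1 h)]
  · rintro rfl
    exact coe_triple_mem_atomicDiagram.2 (mul_one 1)

section Index

variable {e : ℕ} {U : Set ℕ} [Group U]

theorem IsIndexOf.one_mem_iff (h : IsIndexOf e U) {n : ℕ} :
    1 ∈ phi e n ↔ n ∈ atomicDiagram U := by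
  refine ⟨fun h₁ => by_contra fun hn => ?_, (h n).1⟩
  exact absurd (Part.mem_unique h₁ ((h n).2 hn)) one_ne_zero

theorem IsIndexOf.zero_mem_iff (h : IsIndexOf e U) {n : ℕ} :
    0 ∈ phi e n ↔ n ∉ atomicDiagram U :=
  ⟨fun h₁ hn => absurd (Part.mem_unique h₁ ((h n).1 hn)) zero_ne_one, (h n).2⟩

end Index

/-! ### Systems of rules for the four properties -/

/-- The set of all `e` for which the rules, indexed by quadruples of numbers, are satisfiable. -/
def satisfiable (rules : ℕ → ℕ → ℕ → ℕ → List Rule) : Set ℕ :=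
  {e | ∃ X, ∀ x y z w, ∀ r ∈ rules x y z w, r.Holds e X}

theorem isPi01_satisfiable₄ {rules : ℕ → ℕ → ℕ → ℕ → List Rule}
    (h : Primrec fun p : ℕ × ℕ × ℕ × ℕ => rules p.1 p.2.1 p.2.2.1 p.2.2.2) :
    IsPi01 (satisfiable rules) := by
  have hq : Primrec fun q : ℕ => (q.unpair.1, q.unpair.2.unpair.1, q.unpair.2.unpair.2.unpair.1,
      q.unpair.2.unpair.2.unpair.2) := by
    have h₁ : Primrec fun q : ℕ => q.unpair.1 := Primrec.fst.comp .unpair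
    have h₂ : Primrec fun q : ℕ => q.unpair.2 := Primrec.snd.comp .unpair
    exact h₁.pair ((h₁.comp h₂).pair ((h₁.comp (h₂.comp h₂)).pair (h₂.comp (h₂.comp h₂))))
  convert isPi01_satisfiable (h.comp hq) using 1
  ext e
  refine exists_congr fun X => ⟨fun h q => h _ _ _ _, fun h x y z w => ?_⟩
  simpa using h (Nat.pair x (Nat.pair y (Nat.pair z w)))

/-- The rules for the cone of positive elements of a left order. -/
def coneRules (x y z _w : ℕ) : List Rule :=
  [([(triple x y z, 1)], [(x, false), (y, false), (z, true)]),
    ([(triple x x x, 1)], [(x, false)]),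
    ([(triple x y z, 1), (triple z z z, 1), (triple x x x, 0)], [(x, true), (y, true)])]

/-- The rules for the cone of positive elements of a two-sided order. -/
def normalConeRules (x y z w : ℕ) : List Rule :=
  ([(triple w x y, 1), (triple z w y, 1)], [(x, false), (z, true)]) :: coneRules x y z w

/-- The rules for the relation which is coded by `Nat.pair x y` and says that `y` is a positive
power of `x`. -/
def powerRules (x y z _w : ℕ) : List Rule :=
  [([], [(Nat.pair x x, true)]),
    ([(triple x y z, 1)], [(Nat.pair x y, false), (Nat.pair x z, true)]),
    ([(triple x x x, 0), (triple y y y, 1)], [(Nat.pair x y, false)])]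

/-- The commutative law. -/
def commRules (x y z _w : ℕ) : List Rule :=
  [([(triple x y z, 1), (triple y x z, 0)], [])]

section Primrec

variable {α β : Type*} [Primcodable α] [Primcodable β]

theorem primrec_singleton {f : α → β} (hf : Primrec f) : Primrec fun a => [f a] :=
  Primrec.list_cons.comp hf (.const [])

theorem primrec_coneRules :
    Primrec fun p : ℕ × ℕ × ℕ × ℕ => coneRules p.1 p.2.1 p.2.2.1 p.2.2.2 := by
  have hx : Primrec fun p : ℕ × ℕ × ℕ × ℕ => p.1 := .fst
  have hy : Primrec fun p : ℕ × ℕ × ℕ × ℕ => p.2.1 := Primrec.fst.comp .snd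
  have hz : Primrec fun p : ℕ × ℕ × ℕ × ℕ => p.2.2.1 := Primrec.fst.comp (Primrec.snd.comp .snd)
  exact Primrec.list_cons.comp (Primrec.pair (primrec_singleton
      ((primrec_triple hx hy hz).pair (.const 1)))
      (Primrec.list_cons.comp (hx.pair (.const false)) (Primrec.list_cons.comp
        (hy.pair (.const false)) (primrec_singleton (hz.pair (.const true))))))
    (Primrec.list_cons.comp (Primrec.pair (primrec_singleton
      ((primrec_triple hx hx hx).pair (.const 1))) (primrec_singleton (hx.pair (.const false))))
    (primrec_singleton (Primrec.pair (Primrec.list_cons.comp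
      ((primrec_triple hx hy hz).pair (.const 1)) (Primrec.list_cons.comp
        ((primrec_triple hz hz hz).pair (.const 1))
        (primrec_singleton ((primrec_triple hx hx hx).pair (.const 0)))))
      (Primrec.list_cons.comp (hx.pair (.const true))
        (primrec_singleton (hy.pair (.const true)))))))

theorem primrec_normalConeRules :
    Primrec fun p : ℕ × ℕ × ℕ × ℕ => normalConeRules p.1 p.2.1 p.2.2.1 p.2.2.2 := by
  have hx : Primrec fun p : ℕ × ℕ × ℕ × ℕ => p.1 := .fst
  have hy : Primrec fun p : ℕ × ℕ × ℕ × ℕ => p.2.1 := Primrec.fst.comp .snd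
  have hz : Primrec fun p : ℕ × ℕ × ℕ × ℕ => p.2.2.1 := Primrec.fst.comp (Primrec.snd.comp .snd)
  have hw : Primrec fun p : ℕ × ℕ × ℕ × ℕ => p.2.2.2 := Primrec.snd.comp (Primrec.snd.comp .snd)
  exact Primrec.list_cons.comp (Primrec.pair (Primrec.list_cons.comp
      ((primrec_triple hw hx hy).pair (.const 1))
      (primrec_singleton ((primrec_triple hz hw hy).pair (.const 1))))
      (Primrec.list_cons.comp (hx.pair (.const false))
        (primrec_singleton (hz.pair (.const true))))) primrec_coneRules

theorem primrec_powerRules :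
    Primrec fun p : ℕ × ℕ × ℕ × ℕ => powerRules p.1 p.2.1 p.2.2.1 p.2.2.2 := by
  have hx : Primrec fun p : ℕ × ℕ × ℕ × ℕ => p.1 := .fst
  have hy : Primrec fun p : ℕ × ℕ × ℕ × ℕ => p.2.1 := Primrec.fst.comp .snd
  have hz : Primrec fun p : ℕ × ℕ × ℕ × ℕ => p.2.2.1 := Primrec.fst.comp (Primrec.snd.comp .snd)
  exact Primrec.list_cons.comp (Primrec.pair (.const [])
      (primrec_singleton ((Primrec₂.natPair.comp hx hx).pair (.const true))))
    (Primrec.list_cons.comp (Primrec.pair (primrec_singleton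
      ((primrec_triple hx hy hz).pair (.const 1)))
      (Primrec.list_cons.comp ((Primrec₂.natPair.comp hx hy).pair (.const false))
        (primrec_singleton ((Primrec₂.natPair.comp hx hz).pair (.const true)))))
    (primrec_singleton (Primrec.pair (Primrec.list_cons.comp
      ((primrec_triple hx hx hx).pair (.const 0))
      (primrec_singleton ((primrec_triple hy hy hy).pair (.const 1))))
      (primrec_singleton ((Primrec₂.natPair.comp hx hy).pair (.const false))))))

theorem primrec_commRules :
    Primrec fun p : ℕ × ℕ × ℕ × ℕ => commRules p.1 p.2.1 p.2.2.1 p.2.2.2 := by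
  have hx : Primrec fun p : ℕ × ℕ × ℕ × ℕ => p.1 := .fst
  have hy : Primrec fun p : ℕ × ℕ × ℕ × ℕ => p.2.1 := Primrec.fst.comp .snd
  have hz : Primrec fun p : ℕ × ℕ × ℕ × ℕ => p.2.2.1 := Primrec.fst.comp (Primrec.snd.comp .snd)
  exact primrec_singleton (Primrec.pair (Primrec.list_cons.comp
      ((primrec_triple hx hy hz).pair (.const 1))
      (primrec_singleton ((primrec_triple hy hx hz).pair (.const 0)))) (.const []))

end Primrec

/-! ### Positive cones -/

/-- `P` is the set of positive elements of a left order. -/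
structure IsPositiveCone {G : Type} [Group G] (P : G → Prop) : Prop where
  mul : ∀ a b, P a → P b → P (a * b)
  not_one : ¬ P 1
  -- Inverses are expressed by a product because the rules see only the multiplication table.
  total : ∀ a b, a * b = 1 → a ≠ 1 → P a ∨ P b

theorem LinearOrder.isPositiveCone {G : Type} [Group G] [LinearOrder G]
    (h : ∀ a g h : G, g ≤ h → a * g ≤ a * h) : IsPositiveCone fun g : G => 1 < g where
  mul a b ha hb := ha.trans_le (by simpa using h a 1 b hb.le)
  not_one := lt_irrefl 1
  total a b hab ha := by
    refine (lt_or_gt_of_ne ha.symm).imp_right fun ha' => lt_of_le_of_ne ?_ ?_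
    · simpa [eq_inv_of_mul_eq_one_right hab] using h b a 1 ha'.le
    · rintro rfl
      exact ha (by simpa using hab)

namespace IsPositiveCone

variable {G : Type} [Group G] {P : G → Prop}

theorem asymm (hP : IsPositiveCone P) {g h : G} (h₁ : P (g⁻¹ * h)) : ¬ P (h⁻¹ * g) := fun h₂ =>
  hP.not_one (by simpa [mul_assoc] using hP.mul _ _ h₁ h₂)

open Classical in
/-- The left order with the positive cone `P`. -/
noncomputable abbrev linearOrder (hP : IsPositiveCone P) : LinearOrder G where
  le g h := g = h ∨ P (g⁻¹ * h)
  le_refl g := .inl rfl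
  le_trans g h k := by
    rintro (rfl | h₁) (rfl | h₂)
    · exact .inl rfl
    · exact .inr h₂
    · exact .inr h₁
    · exact .inr (by simpa [mul_assoc] using hP.mul _ _ h₁ h₂)
  le_antisymm g h := by
    rintro (rfl | h₁) (h₂ | h₂)
    · rfl
    · rfl
    · exact h₂.symm
    · exact absurd h₂ (hP.asymm h₁)
  le_total g h := by
    by_cases hgh : g = h
    · exact .inl (.inl hgh)
    · refine (hP.total (g⁻¹ * h) (h⁻¹ * g) (by simp [mul_assoc]) ?_).imp .inr .inr
      simpa [inv_mul_eq_one] using hgh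
  toDecidableLE := Classical.decRel _

theorem linearOrder_le (hP : IsPositiveCone P) {g h : G} :
    hP.linearOrder.le g h ↔ g = h ∨ P (g⁻¹ * h) := Iff.rfl

end IsPositiveCone

/-- Left invariance is automatic: `(a * g)⁻¹ * (a * h) = g⁻¹ * h`. -/
theorem leftOrderable_iff {G : Type} [Group G] :
    LeftOrderable G ↔ ∃ P : G → Prop, IsPositiveCone P := by
  refine ⟨fun ⟨_, h⟩ => ⟨_, LinearOrder.isPositiveCone h⟩, fun ⟨P, hP⟩ =>
    ⟨hP.linearOrder, fun a g h => ?_⟩⟩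
  rw [hP.linearOrder_le, hP.linearOrder_le]
  exact Or.imp (by rintro rfl; rfl) (by simp [mul_assoc])

/-- Right translation by `a` conjugates `g⁻¹ * h` by `a⁻¹`, so right invariance is normality of the
cone. -/
theorem biOrderable_iff {G : Type} [Group G] :
    BiOrderable G ↔ ∃ P : G → Prop, IsPositiveCone P ∧ ∀ a g, P g → P (a * g * a⁻¹) := by
  constructor
  · rintro ⟨_, h⟩
    refine ⟨_, LinearOrder.isPositiveCone fun a g k hgk => (h a g k hgk).1, fun a g hg => ?_⟩
    refine lt_of_le_of_ne ?_ ?_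
    · simpa using (h a⁻¹ _ _ (h a _ _ hg.le).1).2
    · intro h1
      exact hg.ne (by simpa using (conj_eq_one_iff (a := a) (b := g)).1 h1.symm |>.symm)
  · rintro ⟨P, hP, hc⟩
    refine ⟨hP.linearOrder, fun a g h => ?_⟩
    simp only [hP.linearOrder_le]
    rintro (rfl | h')
    · exact ⟨.inl rfl, .inl rfl⟩
    · exact ⟨.inr (by simpa [mul_assoc] using h'), .inr (by simpa [mul_assoc] using hc a⁻¹ _ h')⟩

theorem torsionFree_iff {G : Type} [Group G] :
    TorsionFree G ↔ ∀ (g : G) (n : ℕ), 0 < n → g ^ n = 1 → g = 1 := by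
  simp [TorsionFree, isOfFinOrder_iff_pow_eq_one]

/-! ### The rules express the properties -/

section Index

variable {e : ℕ} {U : Set ℕ} [Group U]

/-- The disjunction is empty, so `X` plays no role: the premises must never hold together. -/
theorem IsIndexOf.abelian_iff (h : IsIndexOf e U) : Abelian U ↔ e ∈ satisfiable commRules := by
  simp only [satisfiable, commRules, Rule.Holds, Set.mem_ofPred_eq, List.forall_mem_singleton,
    List.forall_mem_cons, h.one_mem_iff, h.zero_mem_iff]
  constructor
  · intro hU
    refine ⟨fun _ => true, fun x y z _ => ?_⟩
    rintro ⟨h₁, h₂⟩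
    obtain ⟨a, b, rfl, rfl, rfl⟩ := triple_mem_atomicDiagram.1 h₁
    exact absurd (coe_triple_mem_atomicDiagram.2 (hU b a)) h₂
  · rintro ⟨X, hX⟩ a b
    by_contra hab
    simpa using hX a b (a * b : U) 0 ⟨coe_triple_mem_atomicDiagram.2 rfl,
      fun h' => hab (coe_triple_mem_atomicDiagram.1 h').symm⟩

/-- `X` need not be exactly the power relation: it suffices that it contains this relation and never
relates a nonidentity element to `1`. -/
theorem IsIndexOf.torsionFree_iff (h : IsIndexOf e U) :
    TorsionFree U ↔ e ∈ satisfiable powerRules := by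
  classical
  rw [GroupDetection.torsionFree_iff]
  simp only [satisfiable, powerRules, Rule.Holds, Set.mem_ofPred_eq, List.forall_mem_singleton,
    List.forall_mem_cons, h.one_mem_iff, h.zero_mem_iff, List.exists_mem_cons_iff,
    List.not_mem_nil, false_and, exists_false, or_false, false_imp_iff, implies_true,
    true_imp_iff, triple_self_mem_atomicDiagram]
  constructor
  · intro hU
    -- The diagonal is added because the first rule has no premise and thus also concerns numbers
    -- outside `U`.
    refine ⟨fun i => decide (i.unpair.1 = i.unpair.2 ∨
      ∃ (g : U) (n : ℕ), 0 < n ∧ i.unpair.1 = g ∧ i.unpair.2 = (g ^ n : U)), fun x y z _ => ?_⟩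
    simp only [Nat.unpair_pair, decide_eq_true_eq, decide_eq_false_iff_not, true_or, true_and]
    refine ⟨fun hm => or_iff_not_imp_left.2 fun h' => ?_, ?_⟩
    · obtain ⟨a, b, rfl, rfl, rfl⟩ := triple_mem_atomicDiagram.1 hm
      rcases not_not.1 h' with h' | ⟨g, n, hn, h₁, h₂⟩
      · exact .inr ⟨a, 2, by simp, rfl, by rw [← Subtype.ext h', pow_two]⟩
      · refine .inr ⟨a, n + 1, n.succ_pos, rfl, ?_⟩
        rw [Subtype.ext h₂, Subtype.ext h₁, pow_succ']
    · rintro ⟨hx, rfl⟩ (h' | ⟨g, n, hn, rfl, h₂⟩)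
      · exact hx h'
      · rw [hU g n hn (Subtype.ext h₂).symm] at hx
        exact hx rfl
  · rintro ⟨X, hX⟩ g n hn hg
    by_contra hg'
    have key : ∀ k, X (Nat.pair g (g ^ (k + 1) : U)) = true := by
      intro k
      induction k with
      | zero => simpa using (hX g 0 0 0).1
      | succ k ih =>
        have := (hX g (g ^ (k + 1) : U) (g ^ (k + 1 + 1) : U) 0).2.1
          (coe_triple_mem_atomicDiagram.2 (pow_succ' _ _).symm)
        simpa [ih] using this
    have := (hX g (1 : U) 0 0).2.2 ⟨fun h' => hg' (Subtype.ext h'), rfl⟩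
    obtain ⟨k, rfl⟩ := Nat.exists_eq_succ_of_ne_zero hn.ne'
    have hk := key k
    rw [hg, this] at hk
    exact absurd hk (by simp)

theorem IsIndexOf.isPositiveCone (h : IsIndexOf e U) {X : ℕ → Bool}
    (hX : ∀ x y z w, ∀ r ∈ coneRules x y z w, r.Holds e X) :
    IsPositiveCone fun g : U => X g = true := by
  simp only [coneRules, Rule.Holds, List.forall_mem_singleton,
    List.forall_mem_cons, h.one_mem_iff, h.zero_mem_iff, List.exists_mem_cons_iff,
    List.not_mem_nil, false_and, exists_false, or_false, triple_self_mem_atomicDiagram] at hX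
  refine ⟨fun a b ha hb => ?_, ?_, fun a b hab ha => ?_⟩
  · simpa [ha, hb] using (hX a b (a * b : U) 0).1 (coe_triple_mem_atomicDiagram.2 rfl)
  · simpa using (hX (1 : U) 0 0 0).2.1 rfl
  · exact (hX a b (1 : U) 0).2.2 ⟨coe_triple_mem_atomicDiagram.2 hab, rfl,
      fun h' => ha (Subtype.ext h')⟩

-- The bits are set to false outside `U`; this is harmless, as the premises force the numbers
-- concerned into `U`.
open Classical in
theorem IsIndexOf.coneRules_holds (h : IsIndexOf e U) {P : U → Prop} (hP : IsPositiveCone P)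
    (x y z w : ℕ) :
    ∀ r ∈ coneRules x y z w, r.Holds e fun i => decide (∃ g : U, i = g ∧ P g) := by
  simp only [coneRules, Rule.Holds, List.forall_mem_singleton,
    List.forall_mem_cons, h.one_mem_iff, h.zero_mem_iff, List.exists_mem_cons_iff,
    List.not_mem_nil, false_and, exists_false, or_false, triple_self_mem_atomicDiagram,
    decide_eq_true_eq, decide_eq_false_iff_not]
  refine ⟨fun hm => ?_, ?_, ?_⟩
  · obtain ⟨a, b, rfl, rfl, rfl⟩ := triple_mem_atomicDiagram.1 hm
    rw [← or_assoc, ← not_and_or, ← imp_iff_not_or]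
    rintro ⟨⟨a', ha, ha'⟩, b', hb, hb'⟩
    rw [← Subtype.ext ha] at ha'
    rw [← Subtype.ext hb] at hb'
    exact ⟨_, rfl, hP.mul a b ha' hb'⟩
  · rintro rfl ⟨g, hg, hg'⟩
    exact hP.not_one (by rwa [Subtype.ext hg])
  · rintro ⟨hm, h₁, h₂⟩
    obtain ⟨a, b, rfl, rfl, rfl⟩ := triple_mem_atomicDiagram.1 hm
    exact (hP.total a b (Subtype.ext h₁) fun h' => h₂ (congrArg _ h')).imp
      (fun h' => ⟨a, rfl, h'⟩) fun h' => ⟨b, rfl, h'⟩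

theorem IsIndexOf.leftOrderable_iff (h : IsIndexOf e U) :
    LeftOrderable U ↔ e ∈ satisfiable coneRules := by
  rw [GroupDetection.leftOrderable_iff]
  exact ⟨fun ⟨_, hP⟩ => ⟨_, h.coneRules_holds hP⟩, fun ⟨_, hX⟩ => ⟨_, h.isPositiveCone hX⟩⟩

/-- The additional rule expresses conjugation without inverses: `w * x = y = z * w` means `z = w * x
* w⁻¹`. -/
theorem IsIndexOf.biOrderable_iff (h : IsIndexOf e U) :
    BiOrderable U ↔ e ∈ satisfiable normalConeRules := by
  classical
  rw [GroupDetection.biOrderable_iff]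
  constructor
  · rintro ⟨P, hP, hc⟩
    refine ⟨_, fun x y z w => List.forall_mem_cons.2 ⟨?_, h.coneRules_holds hP x y z w⟩⟩
    simp only [Rule.Holds, List.forall_mem_singleton,
      List.forall_mem_cons, h.one_mem_iff, List.exists_mem_cons_iff,
      List.not_mem_nil, false_and, exists_false, or_false,
      decide_eq_true_eq, decide_eq_false_iff_not]
    rintro ⟨h₁, h₂⟩
    obtain ⟨a, g, rfl, rfl, rfl⟩ := triple_mem_atomicDiagram.1 h₁
    obtain ⟨k, a', rfl, ha, hk⟩ := triple_mem_atomicDiagram.1 h₂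
    rw [← imp_iff_not_or]
    rintro ⟨g', hg, hg'⟩
    rw [← Subtype.ext hg] at hg'
    refine ⟨k, rfl, ?_⟩
    rw [← Subtype.ext ha] at hk
    rw [← mul_inv_eq_of_eq_mul (Subtype.ext hk)]
    exact hc a g hg'
  · rintro ⟨X, hX⟩
    refine ⟨_, h.isPositiveCone fun x y z w r hr => hX x y z w r (List.mem_cons_of_mem _ hr),
      fun a g hg => ?_⟩
    have := hX g (a * g : U) (a * g * a⁻¹ : U) a _ List.mem_cons_self
    simp only [Rule.Holds, List.forall_mem_singleton, List.forall_mem_cons, h.one_mem_iff,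
      coe_triple_mem_atomicDiagram] at this
    simpa [hg] using this

end Index


/-! ### Implications between the properties -/

theorem BiOrderable.leftOrderable {G : Type} [Group G] : BiOrderable G → LeftOrderable G :=
  fun ⟨o, h⟩ => ⟨o, fun a g k hgk => (h a g k hgk).1⟩

theorem IsPositiveCone.pow {G : Type} [Group G] {P : G → Prop} (hP : IsPositiveCone P) {g : G}
    (hg : P g) (n : ℕ) : P (g ^ (n + 1)) := by
  induction n with
  | zero => simpa using hg
  | succ n ih => exact pow_succ g (n + 1) ▸ hP.mul _ _ ih hg

/-- If `g ≠ 1`, then `g` or `g⁻¹` is positive, and so are its positive powers, which therefore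
differ from `1`. -/
theorem LeftOrderable.torsionFree {G : Type} [Group G] (h : LeftOrderable G) : TorsionFree G := by
  obtain ⟨P, hP⟩ := leftOrderable_iff.1 h
  refine torsionFree_iff.2 fun g n hn hgn => by_contra fun hg => ?_
  obtain ⟨k, rfl⟩ := Nat.exists_eq_succ_of_ne_zero hn.ne'
  rcases hP.total g g⁻¹ (mul_inv_cancel g) hg with h' | h'
  · exact hP.not_one (hgn ▸ hP.pow h' k)
  · exact hP.not_one (by simpa [hgn] using hP.pow h' k)

/-! ### The infinite dihedral group and its codes -/

/-- The infinite dihedral group: `⟨n, false⟩` is the translation by `n`, and `⟨n, true⟩` is a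
reflection. -/
@[ext]
structure InfiniteDihedral where
  /-- The translation part. -/
  shift : ℤ
  /-- Whether the isometry is a reflection. -/
  flip : Bool
deriving DecidableEq

namespace InfiniteDihedral

/-- The element `⟨a, i⟩` acts as `x ↦ x + a` or, if `i` is true, `x ↦ -x + a`; in `g * h`, `g` acts
first. -/
instance : Mul InfiniteDihedral :=
  ⟨fun g h => ⟨h.shift + bif h.flip then -g.shift else g.shift, xor g.flip h.flip⟩⟩

instance : One InfiniteDihedral := ⟨⟨0, false⟩⟩

instance : Inv InfiniteDihedral := ⟨fun g => ⟨bif g.flip then g.shift else -g.shift, g.flip⟩⟩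

@[simp] theorem mul_shift (g h : InfiniteDihedral) :
    (g * h).shift = h.shift + bif h.flip then -g.shift else g.shift := rfl

@[simp] theorem mul_flip (g h : InfiniteDihedral) : (g * h).flip = xor g.flip h.flip := rfl

@[simp] theorem one_shift : (1 : InfiniteDihedral).shift = 0 := rfl

@[simp] theorem one_flip : (1 : InfiniteDihedral).flip = false := rfl

@[simp] theorem inv_shift (g : InfiniteDihedral) :
    (g⁻¹).shift = bif g.flip then g.shift else -g.shift := rfl

@[simp] theorem inv_flip (g : InfiniteDihedral) : (g⁻¹).flip = g.flip := rfl

instance : Group InfiniteDihedral :=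
  Group.ofLeftAxioms
    (fun ⟨a, i⟩ ⟨b, j⟩ ⟨c, k⟩ => by
      ext <;> cases i <;> cases j <;> cases k <;> simp <;> ring)
    (fun ⟨a, i⟩ => by ext <;> cases i <;> simp)
    (fun ⟨a, i⟩ => by ext <;> cases i <;> simp)

/-- The infinite dihedral group if `p` holds, and its subgroup of translations otherwise. -/
def subgroupIf (p : Prop) : Subgroup InfiniteDihedral where
  carrier := {g | g.flip = true → p}
  mul_mem' {g h} hg hh := by
    intro hgh
    cases hf : g.flip
    · exact hh (by simpa [hf] using hgh)
    · exact hg hf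
  one_mem' := by simp
  inv_mem' h := h

/-- The code of an element of the infinite dihedral group, where the codes of the reflections
depend on the parameter `s`. -/
def code (s : ℕ) (g : InfiniteDihedral) : ℕ :=
  Nat.pair (Nat.pair g.shift.toNat (-g.shift).toNat) (bif g.flip then s + 1 else 0)

/-- The element with a given code. -/
def ofCode (x : ℕ) : InfiniteDihedral :=
  ⟨(x.unpair.1.unpair.1 : ℤ) - x.unpair.1.unpair.2, decide (x.unpair.2 ≠ 0)⟩

@[simp] theorem ofCode_code (s : ℕ) (g : InfiniteDihedral) : ofCode (code s g) = g := by
  ext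
  · simp [ofCode, code]
  · cases h : g.flip <;> simp [ofCode, code, h]

/-- `x` is the code of an element of `subgroupIf`, where `first s` says that the parameter is `s`
and the reflections belong to the subgroup. -/
def IsCode (first : ℕ → Bool) (x : ℕ) : Bool :=
  -- An integer is coded by its positive and negative parts, one of which vanishes. Tag `0` marks
  -- translations, and `pred` undoes the shift in the tag `s + 1`.
  decide (x.unpair.1.unpair.1 * x.unpair.1.unpair.2 = 0) &&
    (decide (x.unpair.2 = 0) || first x.unpair.2.pred)

/-- The truth of `p` need not be decided: the code of a reflection names the only `s` that could
witness it, and `first` checks this candidate. -/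
theorem isCode_iff {first : ℕ → Bool} {p : Prop} {s : ℕ}
    (h : ∀ k, first k = true ↔ p ∧ k = s) {x : ℕ} :
    IsCode first x = true ↔ ∃ g ∈ subgroupIf p, code s g = x := by
  constructor
  · intro hx
    obtain ⟨u, w, rfl⟩ : ∃ u w, x = Nat.pair u w := ⟨_, _, x.pair_unpair.symm⟩
    obtain ⟨a, b, rfl⟩ : ∃ a b, u = Nat.pair a b := ⟨_, _, u.pair_unpair.symm⟩
    simp only [IsCode, Nat.unpair_pair, Bool.and_eq_true, decide_eq_true_eq, Bool.or_eq_true, h,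
      mul_eq_zero] at hx
    obtain ⟨hab, hw⟩ := hx
    refine ⟨ofCode (Nat.pair (Nat.pair a b) w), fun hf => ?_, ?_⟩
    · simp only [ofCode, Nat.unpair_pair, decide_eq_true_eq] at hf
      exact (hw.resolve_left hf).1
    · simp only [ofCode, code, Nat.unpair_pair, Nat.pair_eq_pair]
      refine ⟨by omega, ?_⟩
      rcases Nat.eq_zero_or_eq_succ_pred w with h0 | h1
      · simp [h0]
      · rw [h1] at hw ⊢
        simpa using (hw.resolve_left (Nat.succ_ne_zero _)).2.symm
  · rintro ⟨g, hg, rfl⟩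
    simp only [IsCode, code, Nat.unpair_pair, Bool.and_eq_true, decide_eq_true_eq,
      Bool.or_eq_true, h, mul_eq_zero]
    refine ⟨by omega, ?_⟩
    cases hf : g.flip
    · simp
    · exact .inr ⟨hg hf, by simp⟩

/-- The universe of the copy of `subgroupIf p` with the parameter `s`. -/
def univ (p : Prop) (s : ℕ) : Set ℕ := Set.range fun g : subgroupIf p => code s g

/-- The enumeration of the universe. -/
noncomputable def equivUniv (p : Prop) (s : ℕ) : subgroupIf p ≃ univ p s :=
  Equiv.ofInjective _ fun g h hgh => Subtype.ext (by simpa using congrArg ofCode hgh)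

noncomputable instance (p : Prop) (s : ℕ) : Group (univ p s) := (equivUniv p s).symm.group

/-- The group on the universe is isomorphic to `subgroupIf p`. -/
noncomputable def mulEquivUniv (p : Prop) (s : ℕ) : univ p s ≃* subgroupIf p :=
  (equivUniv p s).symm.mulEquiv

theorem code_mulEquivUniv (p : Prop) (s : ℕ) (x : univ p s) :
    code s (mulEquivUniv p s x) = x :=
  congrArg Subtype.val ((equivUniv p s).apply_symm_apply x)

theorem mulEquivUniv_eq_ofCode (p : Prop) (s : ℕ) (x : univ p s) :
    (mulEquivUniv p s x : InfiniteDihedral) = ofCode x := by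
  rw [← code_mulEquivUniv p s x, ofCode_code]

/-- Moving the subtracted parts to the other side leaves sums of natural numbers, so the relation is
visibly primitive recursive. -/
theorem ofCode_mul_ofCode_eq {x y z : ℕ} : ofCode x * ofCode y = ofCode z ↔
    (if y.unpair.2 = 0 then
      x.unpair.1.unpair.1 + y.unpair.1.unpair.1 + z.unpair.1.unpair.2 =
        x.unpair.1.unpair.2 + y.unpair.1.unpair.2 + z.unpair.1.unpair.1
    else
      x.unpair.1.unpair.2 + y.unpair.1.unpair.1 + z.unpair.1.unpair.2 =
        x.unpair.1.unpair.1 + y.unpair.1.unpair.2 + z.unpair.1.unpair.1) ∧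
    ((x.unpair.2 = 0 ↔ y.unpair.2 = 0) ↔ z.unpair.2 = 0) := by
  rw [InfiniteDihedral.ext_iff]
  refine and_congr ?_ ?_
  · split_ifs with h
    · simp only [mul_shift, ofCode, h, ne_eq, not_true, decide_false, cond_false]
      omega
    · simp only [mul_shift, ofCode, h, ne_eq, not_false_iff, decide_true, cond_true]
      omega
  · by_cases hx : x.unpair.2 = 0 <;> by_cases hy : y.unpair.2 = 0 <;>
      by_cases hz : z.unpair.2 = 0 <;> simp [ofCode, hx, hy, hz]

theorem primrecPred_ofCode_mul : PrimrecPred fun p : ℕ × ℕ × ℕ =>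
    ofCode p.1 * ofCode p.2.1 = ofCode p.2.2 := by
  have hl : Primrec fun x : ℕ => x.unpair.1 := Primrec.fst.comp .unpair
  have hr : Primrec fun x : ℕ => x.unpair.2 := Primrec.snd.comp .unpair
  have hll := hl.comp hl
  have hrl := hr.comp hl
  have hx : Primrec fun p : ℕ × ℕ × ℕ => p.1 := .fst
  have hy : Primrec fun p : ℕ × ℕ × ℕ => p.2.1 := Primrec.fst.comp .snd
  have hz : Primrec fun p : ℕ × ℕ × ℕ => p.2.2 := Primrec.snd.comp .snd
  have add {f g h : ℕ × ℕ × ℕ → ℕ} (hf : Primrec f) (hg : Primrec g) (hh : Primrec h) :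
      Primrec fun p => f p + g p + h p := Primrec.nat_add.comp (Primrec.nat_add.comp hf hg) hh
  have zero {f : ℕ × ℕ × ℕ → ℕ} (hf : Primrec f) : PrimrecPred fun p => (f p).unpair.2 = 0 :=
    Primrec.eq.comp (hr.comp hf) (.const 0)
  have iff {p q : ℕ × ℕ × ℕ → Prop} (hp : PrimrecPred p) (hq : PrimrecPred q) :
      PrimrecPred fun a => (p a ↔ q a) :=
    ((hp.and hq).or (hp.not.and hq.not)).of_eq fun a => by tauto
  have h₁ : PrimrecPred fun p : ℕ × ℕ × ℕ => _ :=
    Primrec.eq.comp (add (hll.comp hx) (hll.comp hy) (hrl.comp hz))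
      (add (hrl.comp hx) (hrl.comp hy) (hll.comp hz))
  have h₂ : PrimrecPred fun p : ℕ × ℕ × ℕ => _ :=
    Primrec.eq.comp (add (hrl.comp hx) (hll.comp hy) (hrl.comp hz))
      (add (hll.comp hx) (hrl.comp hy) (hll.comp hz))
  refine ((((zero hy).and h₁).or ((zero hy).not.and h₂)).and
    (iff (iff (zero hx) (zero hy)) (zero hz))).of_eq fun p => ?_
  rw [ofCode_mul_ofCode_eq, ite_prop_iff_or]

end InfiniteDihedral


/-! ### The computable multiplication table -/

open InfiniteDihedral

namespace InfiniteDihedral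

/-- The characteristic function of the multiplication table of the group on `univ`. -/
def table (first : ℕ → Bool) (n : ℕ) : Bool :=
  (IsCode first n.unpair.1 && (IsCode first n.unpair.2.unpair.1 &&
    IsCode first n.unpair.2.unpair.2)) &&
    decide (ofCode n.unpair.1 * ofCode n.unpair.2.unpair.1 = ofCode n.unpair.2.unpair.2)

/-- `ofCode` forgets the tag and accepts every number; it is injective on `univ p s`, so products
may be compared through it once the codes are checked. -/
theorem table_iff {first : ℕ → Bool} {p : Prop} {s : ℕ}
    (h : ∀ k, first k = true ↔ p ∧ k = s) {n : ℕ} :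
    table first n = true ↔ n ∈ atomicDiagram (univ p s) := by
  have hc : ∀ x, IsCode first x = true ↔ x ∈ univ p s := fun x => by
    rw [isCode_iff h]; simp [univ]
  have hm : ∀ x y z : univ p s, x * y = z ↔ ofCode x * ofCode y = ofCode z := fun x y z => by
    rw [← mulEquivUniv_eq_ofCode, ← mulEquivUniv_eq_ofCode, ← mulEquivUniv_eq_ofCode,
      ← (mulEquivUniv p s).injective.eq_iff, map_mul, Subtype.ext_iff, Subgroup.coe_mul]
  obtain ⟨x, w, rfl⟩ : ∃ x w, n = Nat.pair x w := ⟨_, _, n.pair_unpair.symm⟩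
  obtain ⟨y, z, rfl⟩ : ∃ y z, w = Nat.pair y z := ⟨_, _, w.pair_unpair.symm⟩
  simp only [table, Nat.unpair_pair, Bool.and_eq_true, hc, decide_eq_true_eq]
  constructor
  · rintro ⟨⟨hx, hy, hz⟩, h'⟩
    exact coe_triple_mem_atomicDiagram.2 ((hm ⟨x, hx⟩ ⟨y, hy⟩ ⟨z, hz⟩).2 h')
  · intro h'
    obtain ⟨a, b, rfl, rfl, rfl⟩ := triple_mem_atomicDiagram.1 h'
    exact ⟨⟨a.2, b.2, (a * b).2⟩, (hm a b _).1 rfl⟩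

theorem computable_isCode {first : ℕ → ℕ → Bool} (h : Computable₂ first) :
    Computable₂ fun e x => IsCode (first e) x := by
  have hl : Primrec fun x : ℕ => x.unpair.1 := Primrec.fst.comp .unpair
  have hr : Primrec fun x : ℕ => x.unpair.2 := Primrec.snd.comp .unpair
  have h₁ : Primrec fun p : ℕ × ℕ => decide (p.2.unpair.1.unpair.1 * p.2.unpair.1.unpair.2 = 0) :=
    PrimrecPred.decide (Primrec.eq.comp (Primrec.nat_mul.comp (hl.comp (hl.comp .snd))
      (hr.comp (hl.comp .snd))) (.const 0))
  have h₂ : Primrec fun p : ℕ × ℕ => decide (p.2.unpair.2 = 0) :=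
    PrimrecPred.decide (Primrec.eq.comp (hr.comp .snd) (.const 0))
  exact Primrec.and.to_comp.comp h₁.to_comp (Primrec.or.to_comp.comp h₂.to_comp
    (h.comp .fst (Primrec.pred.comp (hr.comp .snd)).to_comp))

theorem computable_table {first : ℕ → ℕ → Bool} (h : Computable₂ first) :
    Computable₂ fun e n => table (first e) n := by
  have hl : Primrec fun x : ℕ => x.unpair.1 := Primrec.fst.comp .unpair
  have hr : Primrec fun x : ℕ => x.unpair.2 := Primrec.snd.comp .unpair
  have hx : Primrec fun p : ℕ × ℕ => p.2.unpair.1 := hl.comp .snd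
  have hy : Primrec fun p : ℕ × ℕ => p.2.unpair.2.unpair.1 := hl.comp (hr.comp .snd)
  have hz : Primrec fun p : ℕ × ℕ => p.2.unpair.2.unpair.2 := hr.comp (hr.comp .snd)
  have hc {f : ℕ × ℕ → ℕ} (hf : Primrec f) : Computable fun p : ℕ × ℕ => IsCode (first p.1) (f p) :=
    (computable_isCode h).comp .fst hf.to_comp
  have hm : PrimrecPred fun p : ℕ × ℕ => ofCode p.2.unpair.1 * ofCode p.2.unpair.2.unpair.1 =
      ofCode p.2.unpair.2.unpair.2 := by
    have := PrimrecPred.comp (f := fun p : ℕ × ℕ =>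
      (p.2.unpair.1, p.2.unpair.2.unpair.1, p.2.unpair.2.unpair.2)) primrecPred_ofCode_mul
      (hx.pair (hy.pair hz))
    exact this
  have hc' : Computable fun p : ℕ × ℕ => IsCode (first p.1) p.2.unpair.1 &&
      (IsCode (first p.1) p.2.unpair.2.unpair.1 && IsCode (first p.1) p.2.unpair.2.unpair.2) :=
    Primrec.and.to_comp.comp (hc hx) (Primrec.and.to_comp.comp (hc hy) (hc hz))
  have hd := hm.decide.to_comp
  exact (Primrec.and.to_comp.comp hc' hd).of_eq fun p => rfl

variable {p : Prop} {s : ℕ}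

theorem flip_eq_false (hp : ¬p) (g : subgroupIf p) : (g : InfiniteDihedral).flip = false :=
  Bool.eq_false_iff.2 fun h => hp (g.2 h)

theorem abelian_univ (hp : ¬p) : Abelian (univ p s) := by
  intro x y
  apply (mulEquivUniv p s).injective
  rw [map_mul, map_mul]
  ext
  · simp [flip_eq_false hp, add_comm]
  · simp [flip_eq_false hp]

/-- Without reflections, the shift identifies the group with `ℤ`; conjugation is trivial there. -/
theorem biOrderable_univ (hp : ¬p) : BiOrderable (univ p s) := by
  refine biOrderable_iff.2 ⟨fun x => 0 < (mulEquivUniv p s x : InfiniteDihedral).shift,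
    ⟨fun a b ha hb => ?_, by simp, fun a b hab ha => ?_⟩, fun a g hg => ?_⟩
  · simpa [flip_eq_false hp] using add_pos hb ha
  · rw [← inv_eq_of_mul_eq_one_right hab]
    have : (mulEquivUniv p s a : InfiniteDihedral).shift ≠ 0 := fun h => ha <| by
      apply (mulEquivUniv p s).injective
      ext
      · simpa using h
      · simp [flip_eq_false hp]
    simpa [flip_eq_false hp] using this.symm.lt_or_gt
  · rwa [abelian_univ hp a g, mul_inv_cancel_right]

theorem not_abelian_univ (hp : p) : ¬ Abelian (univ p s) := by
  intro h
  have := h ((mulEquivUniv p s).symm ⟨⟨1, false⟩, fun _ => hp⟩)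
    ((mulEquivUniv p s).symm ⟨⟨0, true⟩, fun _ => hp⟩)
  rw [← map_mul, ← map_mul, (mulEquivUniv p s).symm.injective.eq_iff, Subtype.ext_iff,
    InfiniteDihedral.ext_iff] at this
  simp at this

theorem not_torsionFree_univ (hp : p) : ¬ TorsionFree (univ p s) := by
  intro h
  have := torsionFree_iff.1 h ((mulEquivUniv p s).symm ⟨⟨0, true⟩, fun _ => hp⟩) 2 two_pos (by
    rw [← map_pow, map_eq_one_iff _ (mulEquivUniv p s).symm.injective, Subtype.ext_iff, pow_two]
    ext <;> simp)
  rw [map_eq_one_iff _ (mulEquivUniv p s).symm.injective, Subtype.ext_iff,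
    InfiniteDihedral.ext_iff] at this
  simp at this

end InfiniteDihedral

/-! ### The reduction -/

/-- A uniformly decidable family of sets has a computable function giving the indices. -/
theorem exists_computable_decides {t : ℕ → ℕ → Bool} (ht : Computable₂ t) :
    ∃ f : ℕ → ℕ, Computable f ∧ ∀ e, Decides (f e) {n | t e n = true} := by
  have hc : Computable fun m : ℕ => (t m.unpair.1 m.unpair.2).toNat :=
    (Primrec.dom_bool Bool.toNat).to_comp.comp (ht.comp (Computable.fst.comp .unpair)
      (Computable.snd.comp .unpair))
  obtain ⟨c, hc⟩ := Nat.Partrec.Code.exists_code.1 (Partrec.nat_iff.1 hc.partrec)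
  -- The s-m-n theorem: `curry` fixes the parameter `e` in a single code for all tables.
  refine ⟨fun e => Encodable.encode (c.curry e), (Primrec.encode.comp
    (Nat.Partrec.Code.primrec₂_curry.comp (.const c) .id)).to_comp, fun e n => ?_⟩
  have h : phi (Encodable.encode (c.curry e)) n = Part.some (t e n).toNat := by
    rw [phi, Denumerable.ofNat_encode, Nat.Partrec.Code.eval_curry, hc]
    simp
  rw [h]
  cases hn : t e n <;> simp [hn]

/-- The first `n` with `f n = false`. -/
def isFirstFalse (f : ℕ → Bool) (n : ℕ) : Bool :=
  Nat.rec (motive := fun _ => Bool) true (fun i b => b && f i) n && !f n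

/-- This is the hypothesis of `table_iff`. If `f` is never false, the infimum takes its default
value `0`, but the first conjunct already fails. -/
theorem isFirstFalse_iff {f : ℕ → Bool} {n : ℕ} :
    isFirstFalse f n = true ↔ (¬ ∀ k, f k = true) ∧ n = sInf {k | f k = false} := by
  have h : Nat.rec (motive := fun _ => Bool) true (fun i b => b && f i) n = true ↔
      ∀ i < n, f i = true := by
    induction n with
    | zero => simp
    | succ n ih => simp only [Bool.and_eq_true, ih, Nat.forall_lt_succ_right]
  rw [isFirstFalse, Bool.and_eq_true, h, Bool.not_eq_true']
  constructor
  · rintro ⟨h₁, h₂⟩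
    refine ⟨fun h' => by simp [h'] at h₂, le_antisymm ?_ (Nat.sInf_le h₂)⟩
    refine le_csInf ⟨n, h₂⟩ fun k hk => not_lt.1 fun hkn => ?_
    exact absurd (h₁ k hkn) (by simpa using hk)
  · rintro ⟨h₁, rfl⟩
    refine ⟨fun i hi => by simpa using Nat.notMem_of_lt_sInf hi, ?_⟩
    exact Nat.sInf_mem (s := {k | f k = false}) (by simpa [Set.Nonempty] using h₁)

theorem computable_isFirstFalse {f : ℕ → ℕ → Bool} (hf : Computable₂ f) :
    Computable₂ fun e n => isFirstFalse (f e) n := by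
  have hs : Computable₂ fun (p : ℕ × ℕ) (q : ℕ × Bool) => q.2 && f p.1 q.1 :=
    Primrec.and.to_comp.comp (Computable.snd.comp .snd)
      (hf.comp (Computable.fst.comp .fst) (Computable.fst.comp .snd))
  exact Primrec.and.to_comp.comp (Computable.nat_rec .snd (.const true) hs)
    (Primrec.not.to_comp.comp hf)

/-- If a property can be read off from the index by a `Π⁰₁` condition and lies between
"abelian and bi-orderable" and "abelian or torsion-free", then its detection is `Π⁰₁`-complete. -/
theorem detectionComplete_of_iff {P : ∀ (G : Type) [Group G], Prop} {Φ : Set ℕ} (hΦ : IsPi01 Φ)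
    (h : ∀ {e : ℕ} {U : Set ℕ} [Group U], IsIndexOf e U → (P U ↔ e ∈ Φ))
    (h₁ : ∀ (G : Type) [Group G], Abelian G → BiOrderable G → P G)
    (h₂ : ∀ (G : Type) [Group G], P G → Abelian G ∨ TorsionFree G) :
    DetectionComplete IsPi01 P := by
  refine ⟨⟨Φ, hΦ, ?_⟩, ?_⟩
  · ext e
    constructor
    · rintro ⟨⟨U, _, hU⟩, he⟩
      exact ⟨U, _, hU, (h hU).2 he⟩
    · rintro ⟨U, _, hU, hP⟩
      exact ⟨⟨U, _, hU⟩, (h hU).1 hP⟩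
  · rintro S ⟨R, hR, rfl⟩
    obtain ⟨r, hr, hRr⟩ := ComputablePred.computable_iff.1 hR
    have hRr : ∀ e n, R e n ↔ r (e, n) = true := fun e n => iff_of_eq (congrFun hRr (e, n))
    obtain ⟨f, hf, hfe⟩ := exists_computable_decides
      (computable_table (computable_isFirstFalse (f := fun e n => r (e, n)) hr))
    have hU : ∀ e, IsIndexOf (f e)
        (univ (¬ ∀ n, r (e, n) = true) (sInf {n | r (e, n) = false})) := fun e n => by
      rw [← table_iff fun k => isFirstFalse_iff (f := fun n => r (e, n))]
      exact hfe e n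
    refine ⟨f, hf, fun e => ⟨_, _, hU e⟩, fun e => ?_⟩
    have hP : f e ∈ indicesWith P ↔
        P (univ (¬ ∀ n, r (e, n) = true) (sInf {n | r (e, n) = false})) :=
      -- Any two groups with the same index agree on `P`, since both answers are read off from `Φ`;
      -- uniqueness of the group is not needed.
      ⟨fun ⟨U, _, hU', hP⟩ => (h (hU e)).2 ((h hU').1 hP), fun hP => ⟨_, _, hU e, hP⟩⟩
    rw [hP]
    simp only [Set.mem_ofPred_eq, hRr]
    constructor
    · intro he
      exact h₁ _ (abelian_univ (not_not.2 he)) (biOrderable_univ (not_not.2 he))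
    · intro hPU
      by_contra he
      exact (h₂ _ hPU).elim (not_abelian_univ he) (not_torsionFree_univ he)

end GroupDetection

theorem mainTheorem4 :
    GroupDetection.DetectionComplete GroupDetection.IsPi01 GroupDetection.Abelian ∧
    GroupDetection.DetectionComplete GroupDetection.IsPi01 GroupDetection.TorsionFree ∧
    GroupDetection.DetectionComplete GroupDetection.IsPi01 GroupDetection.LeftOrderable ∧
    GroupDetection.DetectionComplete GroupDetection.IsPi01 GroupDetection.BiOrderable := by
  open GroupDetection in
  exact ⟨detectionComplete_of_iff (isPi01_satisfiable₄ primrec_commRules)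
      IsIndexOf.abelian_iff (fun _ _ h _ => h) (fun _ _ h => .inl h),
    detectionComplete_of_iff (isPi01_satisfiable₄ primrec_powerRules)
      IsIndexOf.torsionFree_iff (fun _ _ _ h => h.leftOrderable.torsionFree)
      (fun _ _ h => .inr h),
    detectionComplete_of_iff (isPi01_satisfiable₄ primrec_coneRules)
      IsIndexOf.leftOrderable_iff (fun _ _ _ h => h.leftOrderable)
      (fun _ _ h => .inr h.torsionFree),
    detectionComplete_of_iff (isPi01_satisfiable₄ primrec_normalConeRules)
      IsIndexOf.biOrderable_iff (fun _ _ _ h => h)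
      (fun _ _ h => .inr h.leftOrderable.torsionFree)⟩
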